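/- Let $(\mathcal M,g)$ be a $d$-dimensional smooth Riemannian manifold and $p\in\mathcal M$ a point at which the exponential and logarithm maps are globally defined: every geodesic issued from $p$ exists for all times and the Riemannian exponential map $\exp_p:T_p\mathcal M\to\mathcal M$ is a diffeomorphism, with inverse $\log_p$ (every point of a Riemannian symmetric space of non-compact type has this property). Let $\mu_g$ be the Riemannian measure of $\mathcal M$, let $\nu_g$ be the Lebesgue measure of the Euclidean space $(T_p\mathcal M,g_p)$, and let $$J_p(x)=\left|\det\,(d\exp_p)_{\log_p x}\right|,\qquad x\in\mathcal M,$$ be the Jacobian (volume change) of the exponential map, the determinant being taken in orthonormal bases of $T_p\mathcal M$ and $T_x\mathcal M$. Then $J_p>0$ everywhere and $$\frac{d\,(\exp_p)_*\nu_g}{d\mu_g}(x)=J_p(x)^{-1}.$$ Identify $T_p\mathcal M$ with $\mathbb R^d$ by an orthonormal basis, and let $\mu\in\mathbb R^d$ and $\Sigma\in\mathbb R^{d\times d}$ be symmetric positive definite. If $X$ is a random variable in $\mathcal M$ with $\log_p(X)\sim N(\mu,\Sigma)$, that is, $X\sim lG(\mu,\Sigma)$, then the law of $X$ has with respect to $\mu_g$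 the (measurable) density $$f(x)=(2\pi)^{-\frac d2}\det(\Sigma)^{-\frac12}J_p(x)^{-1}\exp\left(-\tfrac12(\log_p(x)-\mu)^\top\Sigma^{-1}(\log_p(x)-\mu)\right).$$ -/

import Mathlib

open MeasureTheory ProbabilityTheory Set Bundle
open scoped Manifold ContDiff Matrix

noncomputable section

namespace LogGaussian

variable {d : ℕ} {M : Type*} [TopologicalSpace M]
  [ChartedSpace (EuclideanSpace ℝ (Fin d)) M]

section Metric

variable [RiemannianBundle (fun x : M => TangentSpace (𝓡 d) x)]

/-- The coordinate vector field `∂ᵢ` of the preferred chart `φ` at `x₀`, at the point with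
coordinates `y` (meaningful for `y` in the target of the chart). -/
def coordField (x₀ : M) (i : Fin d) (y : EuclideanSpace ℝ (Fin d)) :
    TangentSpace (𝓡 d) ((extChartAt (𝓡 d) x₀).symm y) :=
  mfderiv 𝓘(ℝ, EuclideanSpace ℝ (Fin d)) (𝓡 d) (extChartAt (𝓡 d) x₀).symm y
    (EuclideanSpace.single i (1 : ℝ))

/-- The coefficients `g_{ij} = g(∂ᵢ, ∂ⱼ)` of the Riemannian metric in the preferred chart at `x₀`,
as functions of the coordinates. -/
def metricMatrix (x₀ : M) (y : EuclideanSpace ℝ (Fin d)) : Matrix (Fin d) (Fin d) ℝ :=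
  Matrix.of fun i j => inner ℝ (coordField x₀ i y) (coordField x₀ j y)

/-- The partial derivative `∂ᵢ g_{jl}` in the preferred chart at `x₀`. -/
def metricDeriv (x₀ : M) (i j l : Fin d) (y : EuclideanSpace ℝ (Fin d)) : ℝ :=
  fderiv ℝ (fun z => metricMatrix x₀ z j l) y (EuclideanSpace.single i (1 : ℝ))

/-- The Christoffel symbols of the Levi-Civita connection in the preferred chart at `x₀`:
`Γᵏᵢⱼ = ½ ∑ₗ gᵏˡ (∂ᵢ g_{jl} + ∂ⱼ g_{il} - ∂ₗ g_{ij})`. -/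
def christoffel (x₀ : M) (k i j : Fin d) (y : EuclideanSpace ℝ (Fin d)) : ℝ :=
  (1 / 2) * ∑ l, (metricMatrix x₀ y)⁻¹ k l *
    (metricDeriv x₀ i j l y + metricDeriv x₀ j i l y - metricDeriv x₀ l i j y)

/-- A smooth curve `γ : ℝ → M` is a geodesic if, in every preferred chart, its coordinates solve
`cᵏ'' + ∑ᵢⱼ Γᵏᵢⱼ(c) cⁱ' cʲ' = 0`. -/
def IsGeodesic (d : ℕ) {M : Type*} [TopologicalSpace M]
    [ChartedSpace (EuclideanSpace ℝ (Fin d)) M]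
    [RiemannianBundle (fun x : M => TangentSpace (𝓡 d) x)] (γ : ℝ → M) : Prop :=
  ContMDiff 𝓘(ℝ, ℝ) (𝓡 d) ∞ γ ∧
    ∀ (x₀ : M) (t : ℝ), γ t ∈ (extChartAt (𝓡 d) x₀).source → ∀ k : Fin d,
      iteratedDeriv 2 (fun s => extChartAt (𝓡 d) x₀ (γ s) k) t +
        ∑ i, ∑ j, christoffel x₀ k i j (extChartAt (𝓡 d) x₀ (γ t)) *
          deriv (fun s => extChartAt (𝓡 d) x₀ (γ s) i) t *
          deriv (fun s => extChartAt (𝓡 d) x₀ (γ s) j) t = 0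

/-- `γ` is a geodesic, defined for all times, with `γ(0) = p` and `γ'(0) = v`. -/
def IsGeodesicFrom (p : M) (v : TangentSpace (𝓡 d) p) (γ : ℝ → M) : Prop :=
  IsGeodesic d γ ∧
    (⟨γ 0, mfderiv 𝓘(ℝ, ℝ) (𝓡 d) γ 0 (1 : ℝ)⟩ : TangentBundle (𝓡 d) M) = ⟨p, v⟩

open Classical in
/-- The Riemannian exponential map `exp_p(v) = γ_v(1)`, where `γ_v` is the geodesic with
`γ_v(0) = p`, `γ_v'(0) = v` (and the value `p` if `γ_v` is not defined for all times). -/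
def riemannianExp (p : M) (v : TangentSpace (𝓡 d) p) : M :=
  if h : ∃ γ : ℝ → M, IsGeodesicFrom p v γ then h.choose 1 else p

/-- The logarithm map `log_p`, the inverse of `exp_p`. -/
def riemannianLog (p : M) : M → TangentSpace (𝓡 d) p :=
  Function.invFun (riemannianExp p)

/-- The exponential and logarithm maps at `p` are globally well defined: all geodesics issued from
`p` are defined for all times, and `exp_p` is a (`C¹`) diffeomorphism of `T_pM` onto `M`. -/
def HasGlobalLog (d : ℕ) {M : Type*} [TopologicalSpace M]
    [ChartedSpace (EuclideanSpace ℝ (Fin d)) M]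
    [RiemannianBundle (fun x : M => TangentSpace (𝓡 d) x)] (p : M) : Prop :=
  (∀ v : TangentSpace (𝓡 d) p, ∃ γ : ℝ → M, IsGeodesicFrom p v γ) ∧
    ∃ Φ : Diffeomorph 𝓘(ℝ, TangentSpace (𝓡 d) p) (𝓡 d) (TangentSpace (𝓡 d) p) M 1,
      ⇑Φ = riemannianExp p

/-- The differential of `exp_p` at `u`, as a linear map between the inner product spaces
`T_pM = T_u(T_pM)` and `T_{exp_p u}M`. -/
def expDifferential (p : M) (u : TangentSpace (𝓡 d) p) :
    TangentSpace (𝓡 d) p →ₗ[ℝ] TangentSpace (𝓡 d) (riemannianExp p u) where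
  toFun w := mfderiv 𝓘(ℝ, TangentSpace (𝓡 d) p) (𝓡 d) (riemannianExp p) u w
  map_add' := map_add (mfderiv 𝓘(ℝ, TangentSpace (𝓡 d) p) (𝓡 d) (riemannianExp p) u)
  map_smul' := map_smul (mfderiv 𝓘(ℝ, TangentSpace (𝓡 d) p) (𝓡 d) (riemannianExp p) u)

instance (x : M) : FiniteDimensional ℝ (TangentSpace (𝓡 d) x) :=
  inferInstanceAs (FiniteDimensional ℝ (EuclideanSpace ℝ (Fin d)))

/-- The Jacobian `√(det (D* D))` of a linear map `D` between Euclidean spaces; if these have the same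
dimension, it is the absolute value of the determinant of `D` in orthonormal bases. -/
def linearJacobian {V W : Type*} [NormedAddCommGroup V] [InnerProductSpace ℝ V]
    [NormedAddCommGroup W] [InnerProductSpace ℝ W] [FiniteDimensional ℝ V] [FiniteDimensional ℝ W]
    (D : V →ₗ[ℝ] W) : ℝ :=
  √(LinearMap.det (LinearMap.adjoint D ∘ₗ D))

/-- The Jacobian (volume change) `J_p(x)` of the exponential map at `p`, at the point
`x = exp_p u`: the absolute value of the determinant of `D = (d exp_p)_u` in orthonormal bases of
`T_pM` and `T_xM`. -/
def expJacobian (d : ℕ) {M : Type*} [TopologicalSpace M]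
    [ChartedSpace (EuclideanSpace ℝ (Fin d)) M]
    [RiemannianBundle (fun x : M => TangentSpace (𝓡 d) x)] (p x : M) : ℝ :=
  linearJacobian (V := TangentSpace (𝓡 d) p) (expDifferential p (riemannianLog p x))

end Metric

section Measure

instance (x : M) : MeasurableSpace (TangentSpace (𝓡 d) x) := borel _

instance (x : M) : BorelSpace (TangentSpace (𝓡 d) x) := ⟨rfl⟩

variable [RiemannianBundle (fun x : M => TangentSpace (𝓡 d) x)]

/-- The Lebesgue measure of the inner product space `T_pM`. -/
def tangentLebesgue (p : M) : Measure (TangentSpace (𝓡 d) p) :=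
  volume

variable [MeasurableSpace M]

/-- The Riemannian measure on the domain of the preferred chart at `x₀` (extended by zero):
`√(det (g_{ij})) dy¹ ⋯ dyᵈ` in the coordinates of the chart. -/
def chartMeasure (d : ℕ) {M : Type*} [TopologicalSpace M]
    [ChartedSpace (EuclideanSpace ℝ (Fin d)) M]
    [RiemannianBundle (fun x : M => TangentSpace (𝓡 d) x)] [MeasurableSpace M] (x₀ : M) : Measure M :=
  Measure.map (extChartAt (𝓡 d) x₀).symm
    ((volume.restrict (extChartAt (𝓡 d) x₀).target).withDensity
      fun y => ENNReal.ofReal √((metricMatrix x₀ y).det))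

theorem exists_seq_charts (d : ℕ) (M : Type*) [TopologicalSpace M] [SecondCountableTopology M]
    [ChartedSpace (EuclideanSpace ℝ (Fin d)) M] [Nonempty M] :
    ∃ c : ℕ → M, ⋃ n, (extChartAt (𝓡 d) (c n)).source = univ := by
  obtain ⟨s, hs, hU⟩ := TopologicalSpace.countable_cover_nhds
    (fun x : M => extChartAt_source_mem_nhds (I := 𝓡 d) x)
  have hne : s.Nonempty := by
    by_contra h
    rw [not_nonempty_iff_eq_empty] at h
    simp [h] at hU
    exact (univ_nonempty (α := M)).ne_empty hU.symm
  obtain ⟨c, rfl⟩ := hs.exists_eq_range hne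
  exact ⟨c, by simpa [biUnion_range] using hU⟩

/-- The centres of a sequence of preferred charts that cover `M`. -/
def chartSeq (d : ℕ) (M : Type*) [TopologicalSpace M] [SecondCountableTopology M]
    [ChartedSpace (EuclideanSpace ℝ (Fin d)) M] [Nonempty M] : ℕ → M :=
  (exists_seq_charts d M).choose

/-- The Riemannian measure `μ_g` of `M`: the measures `√(det (g_{ij})) dy` of a sequence of charts
that cover `M`, glued along the partition of `M` obtained by making the domains disjoint. By the
change of variables formula it does not depend on the sequence. -/
def riemannianMeasure (d : ℕ) (M : Type*) [TopologicalSpace M] [SecondCountableTopology M]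
    [ChartedSpace (EuclideanSpace ℝ (Fin d)) M] [Nonempty M]
    [RiemannianBundle (fun x : M => TangentSpace (𝓡 d) x)] [MeasurableSpace M] : Measure M :=
  Measure.sum fun n => (chartMeasure d (chartSeq d M n)).restrict
    (disjointed (fun m => (extChartAt (𝓡 d) (chartSeq d M m)).source) n)

/-- `X ~ lG(μ, Σ)` under `P`: `X` is a random variable in `M`, and the coordinates of `log_p X` in
the orthonormal basis `b` of `T_pM` have the Gaussian law `N(μ, Σ)` on `ℝᵈ`. -/
def IsLogGaussian (p : M) (b : OrthonormalBasis (Fin d) ℝ (TangentSpace (𝓡 d) p))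
    (μ : EuclideanSpace ℝ (Fin d)) (S : Matrix (Fin d) (Fin d) ℝ)
    {Ω : Type*} [MeasurableSpace Ω] (X : Ω → M) (P : Measure Ω) : Prop :=
  AEMeasurable X P ∧
    HasLaw (fun a => b.repr (riemannianLog p (X a))) (multivariateGaussian μ S) P

/-- The function
`(2π)^{-d/2} (det Σ)^{-1/2} J_p(x)⁻¹ exp(-½ (log_p x - μ)ᵀ Σ⁻¹ (log_p x - μ))`. -/
def logGaussianDensity (p : M) (b : OrthonormalBasis (Fin d) ℝ (TangentSpace (𝓡 d) p))
    (μ : EuclideanSpace ℝ (Fin d)) (S : Matrix (Fin d) (Fin d) ℝ) (x : M) : ℝ :=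
  (2 * Real.pi) ^ (-(d : ℝ) / 2) * S.det ^ (-(1 / 2) : ℝ) * (expJacobian d p x)⁻¹ *
    Real.exp (-(1 / 2) * (⇑(b.repr (riemannianLog p x) - μ) ⬝ᵥ
      S⁻¹ *ᵥ ⇑(b.repr (riemannianLog p x) - μ)))

end Measure

end LogGaussian

end

/-!
The exponential map, read in an orthonormal basis `b` of `T_pM`, is a global `C¹` parametrization
`Ψ : ℝᵈ → M` (`exists_normalParametrization`): the identification `b.repr` preserves both Lebesgue
measure and the inner product, so that the Jacobian of `exp_p` at `x` becomes
`√(det G(z))`, where `z = Ψ⁻¹(x)` and `G = (⟨dΨ eᵢ, dΨ eⱼ⟩)` is the Gram matrix of `dΨ`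
(`gramMatrix`).

The heart of the proof is that the Riemannian measure is `√(det G) dz` in any global `C¹`
parametrization (`riemannianMeasure_eq_map`). In a chart `φ` the Gram matrix of `φ⁻¹` is the matrix
of the metric, and `Ψ = φ⁻¹ ∘ h` with `h = φ ∘ Ψ`. Hence `G = Lᵀ g(h) L`, where `L` is the matrix
of `dh` (`gramMatrix_comp`), so that `√(det G) = |det dh| √(det g(h))`, and the change of variables
formula for `h` identifies the two measures on the domain of the chart (`chartMeasure_apply`). The
pieces of a countable partition of `M` into subsets of chart domains are then glued.

Since `det G > 0`, a measure `ρ dz` is carried by `Ψ` to the measure of density `ρ / √(det G)` with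
respect to the Riemannian measure (`map_withDensity_eq_riemannianMeasure_withDensity`). For `ρ = 1`
this is the Radon-Nikodym derivative of the image of Lebesgue measure; for `ρ` the density of
`N(μ, Σ)` (`multivariateGaussian_eq_withDensity`) it is the density of the log-Gaussian law.
-/

namespace LogGaussian

/-! ### The density of the Gaussian law on `ℝᵈ` -/

theorem map_withDensity_measurableEquiv {α β : Type*} [MeasurableSpace α] [MeasurableSpace β]
    (e : α ≃ᵐ β) (μ : Measure α) (f : α → ENNReal) :
    Measure.map e (μ.withDensity f) = (Measure.map e μ).withDensity (f ∘ e.symm) := by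
  ext s hs
  rw [Measure.map_apply e.measurable hs, withDensity_apply _ (e.measurable hs),
    withDensity_apply _ hs, e.restrict_map, lintegral_map_equiv]
  simp

theorem pi_withDensity_ofReal {ι : Type*} [Fintype ι] {α : ι → Type*}
    [∀ i, MeasurableSpace (α i)] (μ : ∀ i, Measure (α i)) [∀ i, SigmaFinite (μ i)]
    (f : ∀ i, α i → ℝ) (hf : ∀ i, Integrable (f i) (μ i)) (h0 : ∀ i x, 0 ≤ f i x) :
    Measure.pi (fun i => (μ i).withDensity fun x => ENNReal.ofReal (f i x)) =
      (Measure.pi μ).withDensity fun x => ENNReal.ofReal (∏ i, f i (x i)) := by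
  -- Fubini on boxes; it is available for Bochner integrals, to which the densities are converted.
  refine Measure.pi_eq fun s hs => ?_
  rw [withDensity_apply _ (MeasurableSet.univ_pi hs), Measure.restrict_pi_pi,
    ← ofReal_integral_eq_lintegral_ofReal
      (Integrable.fintype_prod_dep fun i => (hf i).restrict)
      (Filter.Eventually.of_forall fun x => Finset.prod_nonneg fun i _ => h0 i _),
    integral_fintype_prod_eq_prod,
    ENNReal.ofReal_prod_of_nonneg fun i _ => integral_nonneg (h0 i)]
  refine Finset.prod_congr rfl fun i _ => ?_
  rw [withDensity_apply _ (hs i), ofReal_integral_eq_lintegral_ofReal (hf i).restrict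
    (Filter.Eventually.of_forall (h0 i))]

theorem prod_gaussianPDFReal_zero_one {ι : Type*} [Fintype ι] (x : EuclideanSpace ℝ ι) :
    ∏ i, gaussianPDFReal 0 1 (x i) =
      (2 * Real.pi) ^ (-(Fintype.card ι : ℝ) / 2) * Real.exp (-(1 / 2) * ‖x‖ ^ 2) := by
  simp only [gaussianPDFReal, Finset.prod_mul_distrib, ← Real.exp_sum, NNReal.coe_one, mul_one,
    sub_zero, Finset.prod_const, Finset.card_univ, EuclideanSpace.real_norm_sq_eq, Finset.mul_sum]
  congr 1
  · rw [Real.sqrt_eq_rpow, ← Real.rpow_neg (by positivity), ← Real.rpow_natCast,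
      ← Real.rpow_mul (by positivity)]
    congr 1; ring
  · congr 1
    exact Finset.sum_congr rfl fun i _ => by ring

theorem stdGaussian_eq_withDensity (ι : Type*) [Fintype ι] :
    stdGaussian (EuclideanSpace ℝ ι) = volume.withDensity fun x => ENNReal.ofReal
      ((2 * Real.pi) ^ (-(Fintype.card ι : ℝ) / 2) * Real.exp (-(1 / 2) * ‖x‖ ^ 2)) := by
  have h1 : gaussianReal 0 1 = volume.withDensity fun x => ENNReal.ofReal
      (gaussianPDFReal 0 1 x) := gaussianReal_of_var_ne_zero 0 one_ne_zero
  have h2 := map_withDensity_measurableEquiv (MeasurableEquiv.toLp 2 (ι → ℝ)) volume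
    fun x => ENNReal.ofReal (∏ i, gaussianPDFReal 0 1 (x i))
  rw [MeasurableEquiv.coe_toLp, (PiLp.volume_preserving_toLp ι).map_eq] at h2
  rw [← map_pi_eq_stdGaussian, h1,
    pi_withDensity_ofReal _ _ (fun _ => integrable_gaussianPDFReal 0 1)
      (fun _ => gaussianPDFReal_nonneg 0 1)]
  refine h2.trans ?_
  congr 1
  ext x
  exact congrArg ENNReal.ofReal (prod_gaussianPDFReal_zero_one x)

open scoped MatrixOrder in
/-- The law `N(m, S)` is the image of the standard Gaussian law under `x ↦ m + √S x`, and the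
affine change of variables gives its density. -/
theorem multivariateGaussian_eq_withDensity {ι : Type*} [Fintype ι] [DecidableEq ι]
    (m : EuclideanSpace ℝ ι) {S : Matrix ι ι ℝ} (hS : S.PosDef) :
    multivariateGaussian m S = volume.withDensity fun y => ENNReal.ofReal
      ((2 * Real.pi) ^ (-(Fintype.card ι : ℝ) / 2) * S.det ^ (-(1 / 2) : ℝ) *
        Real.exp (-(1 / 2) * (⇑(y - m) ⬝ᵥ S⁻¹ *ᵥ ⇑(y - m)))) := by
  set R := CFC.sqrt S
  have hRR : R * R = S := CFC.sqrt_mul_sqrt_self S hS.posSemidef.nonneg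
  have hRt : Rᵀ = R := by
    have h : star R = R := (CFC.sqrt_nonneg S).isSelfAdjoint
    simpa [Matrix.star_eq_conjTranspose] using h
  have hdet : R.det * R.det = S.det := by rw [← Matrix.det_mul, hRR]
  have hR0 : R.det ≠ 0 := fun h => hS.det_pos.ne' (by rw [← hdet, h, zero_mul])
  have hunit : IsUnit R.det := isUnit_iff_ne_zero.2 hR0
  let T := Matrix.toEuclideanCLM (n := ι) (𝕜 := ℝ)
  have hT1 : ∀ x, T R (T R⁻¹ x) = x := fun x => by
    rw [← mul_apply_eq_comp, ← map_mul, Matrix.mul_nonsing_inv _ hunit, map_one,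
      one_apply_eq_self]
  have hT2 : ∀ x, T R⁻¹ (T R x) = x := fun x => by
    rw [← mul_apply_eq_comp, ← map_mul, Matrix.nonsing_inv_mul _ hunit, map_one,
      one_apply_eq_self]
  -- The affine map `x ↦ m + √S x` that carries the standard Gaussian law to `N(m, S)`.
  let e : EuclideanSpace ℝ ι ≃ᵐ EuclideanSpace ℝ ι :=
    { toFun := fun x => m + T R x
      invFun := fun y => T R⁻¹ (y - m)
      left_inv := fun x => by simp [hT2]
      right_inv := fun y => by simp [hT1]
      measurable_toFun := by dsimp; fun_prop
      measurable_invFun := by dsimp; fun_prop }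
  have hdetT : LinearMap.det (T R : EuclideanSpace ℝ ι →ₗ[ℝ] EuclideanSpace ℝ ι) = R.det := by
    rw [← LinearMap.det_toMatrix (EuclideanSpace.basisFun ι ℝ).toBasis]
    congr 1
    ext i j
    simp [T, LinearMap.toMatrix_apply]
  have hvol : Measure.map e volume =
      ENNReal.ofReal (S.det ^ (-(1 / 2) : ℝ)) • (volume : Measure (EuclideanSpace ℝ ι)) := by
    have he : (e : EuclideanSpace ℝ ι → EuclideanSpace ℝ ι) = (fun x => m + x) ∘
      (T R : EuclideanSpace ℝ ι →ₗ[ℝ] EuclideanSpace ℝ ι) := rfl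
    rw [he, ← Measure.map_map (by fun_prop) (by exact (T R).measurable),
      Measure.map_linearMap_addHaar_eq_smul_addHaar _ (by rwa [hdetT]), Measure.map_smul,
      map_add_left_eq_self, hdetT]
    congr 2
    rw [Real.rpow_neg hS.det_pos.le, ← Real.sqrt_eq_rpow, ← hdet, Real.sqrt_mul_self_eq_abs,
      abs_inv]
  have hnorm : ∀ y, ‖e.symm y‖ ^ 2 = ⇑(y - m) ⬝ᵥ S⁻¹ *ᵥ ⇑(y - m) := fun y => by
    have h : (⇑(e.symm y) : ι → ℝ) = R⁻¹ *ᵥ ⇑(y - m) := rfl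
    have hSi : S⁻¹ = R⁻¹ᵀ * R⁻¹ := by
      rw [Matrix.transpose_nonsing_inv, hRt, ← hRR, Matrix.mul_inv_rev]
    rw [EuclideanSpace.real_norm_sq_eq, h, hSi, ← Matrix.mulVec_mulVec, Matrix.dotProduct_mulVec,
      Matrix.vecMul_transpose]
    simp [dotProduct, sq]
  have hmap : multivariateGaussian m S = Measure.map e (stdGaussian (EuclideanSpace ℝ ι)) := rfl
  rw [hmap, stdGaussian_eq_withDensity, map_withDensity_measurableEquiv, hvol,
    withDensity_smul_measure,
    ← withDensity_smul _ (Measurable.comp (by fun_prop) e.symm.measurable)]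
  congr 1
  ext y
  simp only [Pi.smul_apply, Function.comp_apply, smul_eq_mul, hnorm]
  rw [← ENNReal.ofReal_mul (Real.rpow_nonneg hS.det_pos.le _)]
  congr 1
  ring

/-! ### Gram matrices of parametrizations -/

section GramMatrix

variable {d : ℕ} {M : Type*} [TopologicalSpace M] [ChartedSpace (EuclideanSpace ℝ (Fin d)) M]
  [RiemannianBundle (fun x : M => TangentSpace (𝓡 d) x)]

/-- The Gram matrix `⟨dΨ eᵢ, dΨ eⱼ⟩` of the differential at `z` of a map `Ψ : ℝᵈ → M`, for the
Riemannian inner product of the tangent space at `Ψ z`. -/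
noncomputable def gramMatrix (Ψ : EuclideanSpace ℝ (Fin d) → M) (z : EuclideanSpace ℝ (Fin d)) :
    Matrix (Fin d) (Fin d) ℝ :=
  Matrix.of fun i j => inner ℝ
    (mfderiv 𝓘(ℝ, EuclideanSpace ℝ (Fin d)) (𝓡 d) Ψ z (EuclideanSpace.single i (1 : ℝ)))
    (mfderiv 𝓘(ℝ, EuclideanSpace ℝ (Fin d)) (𝓡 d) Ψ z (EuclideanSpace.single j (1 : ℝ)))

theorem metricMatrix_eq_gramMatrix (x₀ : M) :
    metricMatrix (d := d) x₀ = gramMatrix (extChartAt (𝓡 d) x₀).symm := rfl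

/-- The Gram matrices of the differentials are transformed by `A ↦ Lᵀ A L` under composition with a
map of differential `L`. -/
theorem gramMatrix_comp {χ : EuclideanSpace ℝ (Fin d) → M}
    {h : EuclideanSpace ℝ (Fin d) → EuclideanSpace ℝ (Fin d)} {z : EuclideanSpace ℝ (Fin d)}
    (hχ : MDifferentiableAt 𝓘(ℝ, EuclideanSpace ℝ (Fin d)) (𝓡 d) χ (h z))
    (hh : DifferentiableAt ℝ h z) :
    gramMatrix (χ ∘ h) z =
      (LinearMap.toMatrix (EuclideanSpace.basisFun (Fin d) ℝ).toBasis
        (EuclideanSpace.basisFun (Fin d) ℝ).toBasis (fderiv ℝ h z : _ →ₗ[ℝ] _))ᵀ *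
      gramMatrix χ (h z) *
      LinearMap.toMatrix (EuclideanSpace.basisFun (Fin d) ℝ).toBasis
        (EuclideanSpace.basisFun (Fin d) ℝ).toBasis (fderiv ℝ h z : _ →ₗ[ℝ] _) := by
  set e := (EuclideanSpace.basisFun (Fin d) ℝ).toBasis
  set A := LinearMap.toMatrix e e (fderiv ℝ h z : _ →ₗ[ℝ] _) with hA
  have key : ∀ i, mfderiv 𝓘(ℝ, EuclideanSpace ℝ (Fin d)) (𝓡 d) (χ ∘ h) z
      (EuclideanSpace.single i (1 : ℝ)) = ∑ k, A k i •
        (mfderiv 𝓘(ℝ, EuclideanSpace ℝ (Fin d)) (𝓡 d) χ (h z) (EuclideanSpace.single k (1 : ℝ)) :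
          TangentSpace (𝓡 d) (χ (h z))) := fun i => by
    rw [mfderiv_comp z hχ hh.mdifferentiableAt, mfderiv_eq_fderiv]
    have hsum : fderiv ℝ h z (EuclideanSpace.single i (1 : ℝ)) =
        ∑ k, A k i • EuclideanSpace.single k (1 : ℝ) := by
      ext k
      simp [hA, e, LinearMap.toMatrix_apply, Pi.single_apply]
    refine (congrArg (mfderiv 𝓘(ℝ, EuclideanSpace ℝ (Fin d)) (𝓡 d) χ (h z)) hsum).trans ?_
    exact (map_sum _ _ _).trans (Finset.sum_congr rfl fun k _ => map_smul _ _ _)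
  ext i j
  have hij : gramMatrix (χ ∘ h) z i j = inner ℝ (E := TangentSpace (𝓡 d) (χ (h z)))
      (∑ k, A k i • (mfderiv 𝓘(ℝ, EuclideanSpace ℝ (Fin d)) (𝓡 d) χ (h z)
        (EuclideanSpace.single k (1 : ℝ)) : TangentSpace (𝓡 d) (χ (h z))))
      (∑ k, A k j • (mfderiv 𝓘(ℝ, EuclideanSpace ℝ (Fin d)) (𝓡 d) χ (h z)
        (EuclideanSpace.single k (1 : ℝ)) : TangentSpace (𝓡 d) (χ (h z)))) :=
    congrArg₂ (inner ℝ (E := TangentSpace (𝓡 d) (χ (h z)))) (key i) (key j)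
  rw [hij]
  simp only [sum_inner, inner_sum, real_inner_smul_left, real_inner_smul_right, Matrix.mul_apply,
    Matrix.transpose_apply, gramMatrix, Matrix.of_apply, Finset.sum_mul]
  exact Finset.sum_congr rfl fun k _ => Finset.sum_congr rfl fun l _ => by ring

theorem gramMatrix_congr {f g : EuclideanSpace ℝ (Fin d) → M} {z : EuclideanSpace ℝ (Fin d)}
    (hfg : f =ᶠ[nhds z] g) : gramMatrix f z = gramMatrix g z := by
  -- The two differentials take values in the tangent spaces at the points `f z = g z`, whose inner
  -- products are attached to different terms although the underlying spaces are both `ℝᵈ`.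
  have hinner : ∀ (x y : M) (_ : x = y) (u v : EuclideanSpace ℝ (Fin d)),
      inner ℝ (E := TangentSpace (𝓡 d) x) u v = inner ℝ (E := TangentSpace (𝓡 d) y) u v := by
    rintro x _ rfl u v
    rfl
  ext i j
  refine (hinner _ _ hfg.eq_of_nhds _ _).trans ?_
  have h := hfg.mfderiv_eq (I := 𝓘(ℝ, EuclideanSpace ℝ (Fin d))) (I' := 𝓡 d)
  exact congrArg₂ (inner ℝ (E := TangentSpace (𝓡 d) (g z)))
    (congrArg (fun T : EuclideanSpace ℝ (Fin d) →L[ℝ] EuclideanSpace ℝ (Fin d) =>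
      T (EuclideanSpace.single i (1 : ℝ))) h)
    (congrArg (fun T : EuclideanSpace ℝ (Fin d) →L[ℝ] EuclideanSpace ℝ (Fin d) =>
      T (EuclideanSpace.single j (1 : ℝ))) h)

theorem sqrt_det_gramMatrix_comp {χ : EuclideanSpace ℝ (Fin d) → M}
    {h : EuclideanSpace ℝ (Fin d) → EuclideanSpace ℝ (Fin d)} {z : EuclideanSpace ℝ (Fin d)}
    (hχ : MDifferentiableAt 𝓘(ℝ, EuclideanSpace ℝ (Fin d)) (𝓡 d) χ (h z))
    (hh : DifferentiableAt ℝ h z) :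
    √(gramMatrix (χ ∘ h) z).det = |(fderiv ℝ h z).det| * √(gramMatrix χ (h z)).det := by
  rw [gramMatrix_comp hχ hh, Matrix.det_mul, Matrix.det_mul, Matrix.det_transpose,
    LinearMap.det_toMatrix, mul_right_comm, Real.sqrt_mul (mul_self_nonneg _),
    Real.sqrt_mul_self_eq_abs]

theorem det_gramMatrix_pos {Ψ : EuclideanSpace ℝ (Fin d) → M} {z : EuclideanSpace ℝ (Fin d)}
    (hinj : Function.Injective (mfderiv 𝓘(ℝ, EuclideanSpace ℝ (Fin d)) (𝓡 d) Ψ z)) :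
    0 < (gramMatrix Ψ z).det := by
  have hli : LinearIndependent ℝ fun i : Fin d =>
      (mfderiv 𝓘(ℝ, EuclideanSpace ℝ (Fin d)) (𝓡 d) Ψ z (EuclideanSpace.single i (1 : ℝ)) :
        TangentSpace (𝓡 d) (Ψ z)) := by
    have h : LinearIndependent ℝ fun i : Fin d => EuclideanSpace.single i (1 : ℝ) := by
      have h := (EuclideanSpace.basisFun (Fin d) ℝ).toBasis.linearIndependent
      rwa [OrthonormalBasis.coe_toBasis,
        funext (EuclideanSpace.basisFun_apply (Fin d) ℝ)] at h
    exact h.map' (mfderiv 𝓘(ℝ, EuclideanSpace ℝ (Fin d)) (𝓡 d) Ψ z).toLinearMap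
      (LinearMap.ker_eq_bot.2 hinj)
  exact (Matrix.posDef_gram_of_linearIndependent (𝕜 := ℝ) hli).det_pos

variable [IsManifold (𝓡 d) ∞ M]
  [IsContMDiffRiemannianBundle (𝓡 d) ∞ (EuclideanSpace ℝ (Fin d))
      (fun x : M => TangentSpace (𝓡 d) x)]

theorem continuousOn_gramMatrix {Ψ : EuclideanSpace ℝ (Fin d) → M}
    {s : Set (EuclideanSpace ℝ (Fin d))} (hs : IsOpen s)
    (hΨ : ContMDiffOn 𝓘(ℝ, EuclideanSpace ℝ (Fin d)) (𝓡 d) 1 Ψ s) :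
    ContinuousOn (gramMatrix Ψ) s := by
  have hM : IsManifold (𝓡 d) 1 M := .of_le (n := ∞) (by simp)
  have hg : IsContMDiffRiemannianBundle (𝓡 d) 0 (EuclideanSpace ℝ (Fin d))
      (fun x : M => TangentSpace (𝓡 d) x) := .of_le (n := ∞) (by simp)
  have hv : ∀ i : Fin d, ContinuousOn (fun z => (⟨Ψ z,
      mfderiv 𝓘(ℝ, EuclideanSpace ℝ (Fin d)) (𝓡 d) Ψ z (EuclideanSpace.single i (1 : ℝ))⟩ :
        TangentBundle (𝓡 d) M)) s := fun i => by
    -- The tangent map of `Ψ` is applied to the constant vector field `eᵢ` on `ℝᵈ`.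
    have h := hΨ.continuousOn_tangentMapWithin le_rfl hs.uniqueMDiffOn
    have hsec : Continuous (fun z : EuclideanSpace ℝ (Fin d) =>
      (⟨z, EuclideanSpace.single i (1 : ℝ)⟩ :
        TangentBundle 𝓘(ℝ, EuclideanSpace ℝ (Fin d)) (EuclideanSpace ℝ (Fin d)))) :=
      (tangentBundleModelSpaceHomeomorph 𝓘(ℝ, EuclideanSpace ℝ (Fin d))).symm.continuous.comp
        (continuous_id.prodMk continuous_const)
    refine (h.comp hsec.continuousOn fun z hz => hz).congr fun z hz => ?_
    simp [tangentMapWithin, mfderivWithin_of_isOpen hs hz]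
  refine continuousOn_pi.2 fun i => continuousOn_pi.2 fun j z hz => ?_
  exact (ContMDiffWithinAt.inner_bundle (h := hg) (IB := 𝓡 d) (F := EuclideanSpace ℝ (Fin d))
    (E := fun x : M => TangentSpace (𝓡 d) x) (IM := 𝓘(ℝ, EuclideanSpace ℝ (Fin d)))
    (contMDiffOn_zero_iff.2 (hv i) z hz) (contMDiffOn_zero_iff.2 (hv j) z hz)).continuousWithinAt

end GramMatrix

/-! ### The Riemannian measure in a global parametrization -/

section Parametrization

variable {d : ℕ} {M : Type*} [TopologicalSpace M] [ChartedSpace (EuclideanSpace ℝ (Fin d)) M]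
  (Ψ : Diffeomorph 𝓘(ℝ, EuclideanSpace ℝ (Fin d)) (𝓡 d) (EuclideanSpace ℝ (Fin d)) M 1)

theorem isOpen_preimage_chart_source (x₀ : M) :
    IsOpen (Ψ ⁻¹' (extChartAt (𝓡 d) x₀).source) :=
  (isOpen_extChartAt_source x₀).preimage Ψ.continuous

theorem contDiffOn_chart_comp [IsManifold (𝓡 d) ∞ M] (x₀ : M) :
    ContDiffOn ℝ 1 (extChartAt (𝓡 d) x₀ ∘ Ψ) (Ψ ⁻¹' (extChartAt (𝓡 d) x₀).source) := by
  have hM : IsManifold (𝓡 d) 1 M := .of_le (n := ∞) (by simp)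
  have h := contMDiffOn_extChartAt (I := 𝓡 d) (n := 1) (x := x₀)
  rw [← extChartAt_source (𝓡 d)] at h
  exact (h.comp Ψ.contMDiff.contMDiffOn fun z hz => hz).contDiffOn

variable [RiemannianBundle (fun x : M => TangentSpace (𝓡 d) x)]

theorem det_gramMatrix_diffeomorph_pos (z : EuclideanSpace ℝ (Fin d)) :
    0 < (gramMatrix Ψ z).det := by
  refine det_gramMatrix_pos ?_
  exact (Ψ.mfderivToContinuousLinearEquiv one_ne_zero z).injective

variable [IsManifold (𝓡 d) ∞ M]

/-- The local volume densities of `Ψ` and of a chart differ by the Jacobian of the transition map. -/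
theorem sqrt_det_gramMatrix_eq_chart (x₀ : M) {z : EuclideanSpace ℝ (Fin d)}
    (hz : Ψ z ∈ (extChartAt (𝓡 d) x₀).source) :
    √(gramMatrix Ψ z).det = |(fderiv ℝ (extChartAt (𝓡 d) x₀ ∘ Ψ) z).det| *
      √(metricMatrix x₀ (extChartAt (𝓡 d) x₀ (Ψ z))).det := by
  have hM : IsManifold (𝓡 d) 1 M := .of_le (n := ∞) (by simp)
  have hU := (isOpen_preimage_chart_source Ψ x₀).mem_nhds hz
  have heq : ⇑Ψ =ᶠ[nhds z] (extChartAt (𝓡 d) x₀).symm ∘ (extChartAt (𝓡 d) x₀ ∘ Ψ) := by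
    filter_upwards [hU] with w hw using ((extChartAt (𝓡 d) x₀).left_inv hw).symm
  have hχ : MDifferentiableAt 𝓘(ℝ, EuclideanSpace ℝ (Fin d)) (𝓡 d) (extChartAt (𝓡 d) x₀).symm
      ((extChartAt (𝓡 d) x₀ ∘ Ψ) z) := by
    have ht := (extChartAt (𝓡 d) x₀).map_source hz
    exact ((contMDiffOn_extChartAt_symm (I := 𝓡 d) (n := 1) x₀).contMDiffAt
      ((isOpen_extChartAt_target x₀).mem_nhds ht)).mdifferentiableAt one_ne_zero
  rw [gramMatrix_congr heq, sqrt_det_gramMatrix_comp hχ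
    (((contDiffOn_chart_comp Ψ x₀).contDiffAt hU).differentiableAt one_ne_zero),
    metricMatrix_eq_gramMatrix]
  rfl

theorem measurable_sqrt_det_gramMatrix
    [IsContMDiffRiemannianBundle (𝓡 d) ∞ (EuclideanSpace ℝ (Fin d))
      (fun x : M => TangentSpace (𝓡 d) x)] :
    Measurable fun z => √(gramMatrix Ψ z).det := by
  have h := continuousOn_gramMatrix isOpen_univ Ψ.contMDiff.contMDiffOn
  rw [continuousOn_univ] at h
  exact (Real.continuous_sqrt.comp h.matrix_det).measurable

variable [MeasurableSpace M] [BorelSpace M]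

/-- On the domain of a chart, the Riemannian measure read through a parametrization `Ψ` of `M` is
`√(det ⟨∂ᵢΨ, ∂ⱼΨ⟩) dz`: this is the change of variables formula for the transition map. -/
theorem chartMeasure_apply (x₀ : M) {A : Set M} (hA : MeasurableSet A)
    (hAs : A ⊆ (extChartAt (𝓡 d) x₀).source) :
    chartMeasure d x₀ A = Measure.map Ψ
      (volume.withDensity fun z => ENNReal.ofReal √(gramMatrix Ψ z).det) A := by
  set φ := extChartAt (𝓡 d) x₀
  have htm : MeasurableSet φ.target := (isOpen_extChartAt_target x₀).measurableSet
  have hΨA : MeasurableSet (Ψ ⁻¹' A) := Ψ.continuous.measurable hA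
  have hae : AEMeasurable φ.symm ((volume.restrict φ.target).withDensity
      fun y => ENNReal.ofReal √((metricMatrix x₀ y).det)) :=
    ((continuousOn_extChartAt_symm x₀).aemeasurable htm).mono_ac
      (withDensity_absolutelyContinuous _ _)
  have himage : φ.symm ⁻¹' A ∩ φ.target = (φ ∘ Ψ) '' (Ψ ⁻¹' A) := by
    rw [image_comp, image_preimage_eq (f := Ψ) _ Ψ.toEquiv.surjective]
    ext y
    constructor
    · rintro ⟨hy, hyt⟩
      exact ⟨φ.symm y, hy, φ.right_inv hyt⟩
    · rintro ⟨x, hx, rfl⟩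
      exact ⟨by simpa only [mem_preimage, φ.left_inv (hAs hx)] using hx, φ.map_source (hAs hx)⟩
  have hderiv : ∀ z ∈ Ψ ⁻¹' A, HasFDerivWithinAt (φ ∘ Ψ) (fderiv ℝ (φ ∘ Ψ) z) (Ψ ⁻¹' A) z :=
    fun z hz => (((contDiffOn_chart_comp Ψ x₀).contDiffAt
      ((isOpen_preimage_chart_source Ψ x₀).mem_nhds (hAs hz))).differentiableAt
        one_ne_zero).hasFDerivAt.hasFDerivWithinAt
  have hinj : InjOn (φ ∘ Ψ) (Ψ ⁻¹' A) := fun z hz w hw h =>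
    Ψ.injective (φ.injOn (hAs hz) (hAs hw) h)
  -- `withDensity_apply'` needs no measurability of `φ.symm ⁻¹' A`, which is arbitrary outside the
  -- target of the chart, where `φ.symm` takes junk values.
  rw [chartMeasure, Measure.map_apply_of_aemeasurable hae hA, withDensity_apply',
    Measure.restrict_restrict' htm, himage,
    lintegral_image_eq_lintegral_abs_det_fderiv_mul volume hΨA hderiv hinj,
    Measure.map_apply Ψ.continuous.measurable hA, withDensity_apply _ hΨA]
  refine setLIntegral_congr_fun hΨA fun z hz => ?_
  rw [sqrt_det_gramMatrix_eq_chart Ψ x₀ (hAs hz), ENNReal.ofReal_mul (abs_nonneg _)]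
  rfl

/-- The Riemannian measure is `√(det ⟨∂ᵢΨ, ∂ⱼΨ⟩) dz` in a global parametrization `Ψ`, because the
two measures agree on each piece of the partition of `M` into subsets of chart domains. -/
theorem riemannianMeasure_eq_map [SecondCountableTopology M] [Nonempty M] :
    riemannianMeasure d M = Measure.map Ψ
      (volume.withDensity fun z => ENNReal.ofReal √(gramMatrix Ψ z).det) := by
  set ν := Measure.map Ψ (volume.withDensity fun z => ENNReal.ofReal √(gramMatrix Ψ z).det)
  have hcover := (exists_seq_charts d M).choose_spec
  set U : ℕ → Set M := fun m => (extChartAt (𝓡 d) (chartSeq d M m)).source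
  have hUm : ∀ n, MeasurableSet (U n) := fun n => (isOpen_extChartAt_source _).measurableSet
  have hDm : ∀ n, MeasurableSet (disjointed U n) := MeasurableSet.disjointed hUm
  have hcharts : ∀ n, (chartMeasure d (chartSeq d M n)).restrict (disjointed U n) =
      ν.restrict (disjointed U n) := fun n => by
    ext A hA
    rw [Measure.restrict_apply hA, Measure.restrict_apply hA]
    exact chartMeasure_apply Ψ _ (hA.inter (hDm n))
      (inter_subset_right.trans (disjointed_subset U n))
  have hunion : ⋃ n, disjointed U n = univ := iUnion_disjointed.trans hcover
  calc riemannianMeasure d M = Measure.sum fun n => ν.restrict (disjointed U n) :=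
        congrArg Measure.sum (funext hcharts)
    _ = ν.restrict (⋃ n, disjointed U n) :=
        (Measure.restrict_iUnion (disjoint_disjointed U) hDm).symm
    _ = ν := by rw [hunion, Measure.restrict_univ]

/-- A measure with density `ρ dz` in a global parametrization `Ψ` has, with respect to the
Riemannian measure, the density `ρ / √(det ⟨∂ᵢΨ, ∂ⱼΨ⟩)`. -/
theorem map_withDensity_eq_riemannianMeasure_withDensity
    [IsContMDiffRiemannianBundle (𝓡 d) ∞ (EuclideanSpace ℝ (Fin d))
      (fun x : M => TangentSpace (𝓡 d) x)]
    [SecondCountableTopology M] [Nonempty M]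
    {ρ : EuclideanSpace ℝ (Fin d) → ℝ} (hρ : Measurable ρ) :
    Measure.map Ψ (volume.withDensity fun z => ENNReal.ofReal (ρ z)) =
      (riemannianMeasure d M).withDensity fun x => ENNReal.ofReal
        ((√(gramMatrix Ψ (Ψ.symm x)).det)⁻¹ * ρ (Ψ.symm x)) := by
  let e : EuclideanSpace ℝ (Fin d) ≃ᵐ M := Ψ.toHomeomorph.toMeasurableEquiv
  set J : EuclideanSpace ℝ (Fin d) → ℝ := fun z => √(gramMatrix Ψ z).det
  have hJ0 : ∀ z, 0 < J z := fun z => Real.sqrt_pos.2 (det_gramMatrix_diffeomorph_pos Ψ z)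
  have hJm : Measurable J := measurable_sqrt_det_gramMatrix Ψ
  have hmul : (volume.withDensity fun z => ENNReal.ofReal (ρ z)) =
      (volume.withDensity fun z => ENNReal.ofReal (J z)).withDensity
        fun z => ENNReal.ofReal ((J z)⁻¹ * ρ z) := by
    rw [← withDensity_mul _ hJm.ennreal_ofReal (by fun_prop)]
    congr 1
    ext z
    rw [Pi.mul_apply, ← ENNReal.ofReal_mul (hJ0 z).le, mul_inv_cancel_left₀ (hJ0 z).ne']
  rw [hmul, riemannianMeasure_eq_map Ψ]
  exact map_withDensity_measurableEquiv e _ _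

end Parametrization

/-! ### Normal coordinates and the log-Gaussian law -/

theorem linearJacobian_eq_sqrt_det {d : ℕ} {V W : Type*} [NormedAddCommGroup V]
    [InnerProductSpace ℝ V] [NormedAddCommGroup W] [InnerProductSpace ℝ W]
    [FiniteDimensional ℝ V] [FiniteDimensional ℝ W] (b : OrthonormalBasis (Fin d) ℝ V)
    (D : V →ₗ[ℝ] W) :
    linearJacobian D = √(Matrix.of fun i j => inner ℝ (D (b i)) (D (b j))).det := by
  rw [linearJacobian, ← LinearMap.det_toMatrix b.toBasis]
  congr 2
  ext i j
  rw [LinearMap.toMatrix_apply, b.coe_toBasis_repr_apply, b.repr_apply_apply, b.coe_toBasis,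
    LinearMap.comp_apply, LinearMap.adjoint_inner_right, Matrix.of_apply]

section Exponential

variable {d : ℕ} {M : Type*} [TopologicalSpace M] [ChartedSpace (EuclideanSpace ℝ (Fin d)) M]
  [RiemannianBundle (fun x : M => TangentSpace (𝓡 d) x)] {p : M}

/-- The Jacobian of `exp_p` is the volume density of the normal coordinates. -/
theorem linearJacobian_expDifferential (b : OrthonormalBasis (Fin d) ℝ (TangentSpace (𝓡 d) p))
    (hexp : MDifferentiable 𝓘(ℝ, TangentSpace (𝓡 d) p) (𝓡 d) (riemannianExp (d := d) p))
    (z : EuclideanSpace ℝ (Fin d)) :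
    linearJacobian (V := TangentSpace (𝓡 d) p) (expDifferential p (b.repr.symm z)) =
      √(gramMatrix (riemannianExp (d := d) p ∘ b.repr.symm) z).det := by
  have hb : HasMFDerivAt 𝓘(ℝ, EuclideanSpace ℝ (Fin d)) 𝓘(ℝ, TangentSpace (𝓡 d) p)
      b.repr.symm z (b.repr.symm.toContinuousLinearEquiv.toContinuousLinearMap :
        EuclideanSpace ℝ (Fin d) →L[ℝ] TangentSpace (𝓡 d) p) :=
    HasFDerivAt.hasMFDerivAt b.repr.symm.toContinuousLinearEquiv.hasFDerivAt
  have hD : ∀ i, mfderiv 𝓘(ℝ, EuclideanSpace ℝ (Fin d)) (𝓡 d)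
      (riemannianExp (d := d) p ∘ b.repr.symm) z
      (EuclideanSpace.single i (1 : ℝ)) = expDifferential p (b.repr.symm z) (b i) := fun i => by
    rw [((hexp (b.repr.symm z)).hasMFDerivAt.comp z hb).mfderiv]
    exact congrArg (mfderiv 𝓘(ℝ, TangentSpace (𝓡 d) p) (𝓡 d) (riemannianExp (d := d) p)
      (b.repr.symm z))
      (b.repr_symm_single i)
  rw [linearJacobian_eq_sqrt_det b]
  congr 2
  ext i j
  exact (congrArg₂ (inner ℝ (E := TangentSpace (𝓡 d) (riemannianExp (d := d) p (b.repr.symm z))))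
    (hD i) (hD j)).symm

/-- The parametrization of `M` by `ℝᵈ` given by the exponential map and an orthonormal basis of
`T_pM`, i.e. the normal coordinates at `p`. -/
theorem exists_normalParametrization (hp : HasGlobalLog d p)
    (b : OrthonormalBasis (Fin d) ℝ (TangentSpace (𝓡 d) p)) :
    ∃ Ψ : Diffeomorph 𝓘(ℝ, EuclideanSpace ℝ (Fin d)) (𝓡 d) (EuclideanSpace ℝ (Fin d)) M 1,
      (∀ z, Ψ z = riemannianExp (d := d) p (b.repr.symm z)) ∧
      (∀ x, Ψ.symm x = b.repr (riemannianLog p x)) ∧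
      ∀ x, expJacobian d p x = √(gramMatrix Ψ (Ψ.symm x)).det := by
  obtain ⟨-, Φ, hΦ⟩ := hp
  let L : Diffeomorph 𝓘(ℝ, EuclideanSpace ℝ (Fin d)) 𝓘(ℝ, TangentSpace (𝓡 d) p)
      (EuclideanSpace ℝ (Fin d)) (TangentSpace (𝓡 d) p) 1 :=
    { b.repr.symm.toEquiv with
      contMDiff_toFun := b.repr.symm.toContinuousLinearEquiv.contDiff.contMDiff
      contMDiff_invFun := b.repr.toContinuousLinearEquiv.contDiff.contMDiff }
  have hlog : ∀ x, riemannianLog p x = Φ.symm x := fun x => by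
    have h : Function.LeftInverse (Function.invFun Φ) Φ := Function.leftInverse_invFun Φ.injective
    have h2 := h (Φ.symm x)
    rw [Φ.apply_symm_apply] at h2
    rw [riemannianLog, ← hΦ, h2]
  refine ⟨L.trans Φ, fun z => ?_, fun x => ?_, fun x => ?_⟩
  · rw [← hΦ]; rfl
  · rw [hlog]; rfl
  · have hx : riemannianLog p x = b.repr.symm ((L.trans Φ).symm x) := by
      rw [hlog]
      exact (b.repr.symm_apply_apply _).symm
    have hΨ : ⇑(L.trans Φ) = riemannianExp (d := d) p ∘ b.repr.symm := by rw [← hΦ]; rfl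
    rw [expJacobian, hx, hΨ, linearJacobian_expDifferential b
      (by rw [← hΦ]; exact Φ.contMDiff.mdifferentiable one_ne_zero)]

end Exponential

end LogGaussian

theorem mainTheorem5 {d : ℕ} {M : Type*} [TopologicalSpace M] [T2Space M]
    [SecondCountableTopology M] [ChartedSpace (EuclideanSpace ℝ (Fin d)) M]
    [IsManifold (𝓡 d) ∞ M] [RiemannianBundle (fun x : M => TangentSpace (𝓡 d) x)]
    [IsContMDiffRiemannianBundle (𝓡 d) ∞ (EuclideanSpace ℝ (Fin d))
      (fun x : M => TangentSpace (𝓡 d) x)]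
    [MeasurableSpace M] [BorelSpace M] [Nonempty M]
    (p : M) (hp : LogGaussian.HasGlobalLog d p)
    (b : OrthonormalBasis (Fin d) ℝ (TangentSpace (𝓡 d) p))
    (μ : EuclideanSpace ℝ (Fin d)) (S : Matrix (Fin d) (Fin d) ℝ) (hS : S.PosDef)
    {Ω : Type*} [MeasurableSpace Ω] (P : Measure Ω) [IsProbabilityMeasure P] (X : Ω → M)
    (hX : LogGaussian.IsLogGaussian p b μ S X P) :
    (∀ x, 0 < LogGaussian.expJacobian d p x) ∧
    Measure.map (LogGaussian.riemannianExp (d := d) p) (LogGaussian.tangentLebesgue (d := d) p) =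
      (LogGaussian.riemannianMeasure d M).withDensity
        (fun x => ENNReal.ofReal (LogGaussian.expJacobian d p x)⁻¹) ∧
    Measurable (LogGaussian.logGaussianDensity p b μ S) ∧
    Measure.map X P =
      (LogGaussian.riemannianMeasure d M).withDensity
        (fun x => ENNReal.ofReal (LogGaussian.logGaussianDensity p b μ S x)) := by
  obtain ⟨Ψ, hexp, hlog, hJ⟩ := LogGaussian.exists_normalParametrization hp b
  have hΨm : Measurable Ψ := Ψ.continuous.measurable
  have hΨm' : Measurable Ψ.symm := Ψ.symm.continuous.measurable
  -- The Lebesgue density of `N(μ, S)`.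
  set ρ : EuclideanSpace ℝ (Fin d) → ℝ := fun z =>
    (2 * Real.pi) ^ (-(d : ℝ) / 2) * S.det ^ (-(1 / 2) : ℝ) *
      Real.exp (-(1 / 2) * (⇑(z - μ) ⬝ᵥ S⁻¹ *ᵥ ⇑(z - μ))) with hρ
  have hρm : Measurable ρ := by
    have : Continuous ρ := by
      rw [hρ]
      fun_prop
    exact this.measurable
  have hdens : ∀ x, LogGaussian.logGaussianDensity p b μ S x =
      (√(LogGaussian.gramMatrix Ψ (Ψ.symm x)).det)⁻¹ * ρ (Ψ.symm x) := fun x => by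
    rw [LogGaussian.logGaussianDensity, hJ, ← hlog]
    ring
  refine ⟨fun x => ?_, ?_, ?_, ?_⟩
  · rw [hJ]
    exact Real.sqrt_pos.2 (LogGaussian.det_gramMatrix_diffeomorph_pos Ψ _)
  · have hvol : Measure.map b.repr.symm volume = LogGaussian.tangentLebesgue (d := d) p :=
      b.measurePreserving_repr_symm.map_eq
    have hΨ : ⇑Ψ = LogGaussian.riemannianExp p ∘ b.repr.symm := funext hexp
    have hexpm : Measurable (LogGaussian.riemannianExp (d := d) p) := by
      have h : LogGaussian.riemannianExp p = Ψ ∘ b.repr := by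
        ext u
        simp [hexp]
      rw [h]
      exact hΨm.comp b.repr.continuous.measurable
    have h := LogGaussian.map_withDensity_eq_riemannianMeasure_withDensity Ψ
      (measurable_const (a := (1 : ℝ)))
    simp only [ENNReal.ofReal_one, mul_one, ← hJ] at h
    rw [← Pi.one_def, withDensity_one] at h
    rw [← hvol, Measure.map_map hexpm b.repr.symm.continuous.measurable, ← hΨ]
    exact h
  · rw [funext hdens]
    exact ((LogGaussian.measurable_sqrt_det_gramMatrix Ψ).comp hΨm').inv.mul (hρm.comp hΨm')
  · obtain ⟨-, hlaw⟩ := hX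
    have hXΨ : X = Ψ ∘ fun a => b.repr (LogGaussian.riemannianLog p (X a)) := by
      ext a
      simp [← hlog]
    rw [hXΨ, ← AEMeasurable.map_map_of_aemeasurable hΨm.aemeasurable hlaw.aemeasurable,
      hlaw.map_eq, LogGaussian.multivariateGaussian_eq_withDensity μ hS, Fintype.card_fin,
      funext hdens]
    exact LogGaussian.map_withDensity_eq_riemannianMeasure_withDensity Ψ hρm
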